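/- Let $J=\begin{pmatrix}0&1\\-1&0\end{pmatrix}$. For $\zeta\in\mathbb R$ and $\underline{\mathbf u}=(\underline{\mathbf u}_1,\underline{\mathbf u}_2)^\top\in L^\infty(\mathbb R;\mathbb R^2)$ consider the operator $$\mathcal L(\underline{\mathbf u})=J\left(-\partial_x^2+\zeta-\begin{pmatrix}3\underline{\mathbf u}_1^2+\underline{\mathbf u}_2^2&2\underline{\mathbf u}_1\underline{\mathbf u}_2\\2\underline{\mathbf u}_1\underline{\mathbf u}_2&\underline{\mathbf u}_1^2+3\underline{\mathbf u}_2^2\end{pmatrix}\right)$$ on $L^2(\mathbb R;\mathbb C^2)$ with domain $H^2(\mathbb R;\mathbb C^2)$. Fix $\rho>0$ and $\zeta\in\mathbb R$. Then there exist constants $\eta_1,\eta_2>0$, depending only on $\rho$ and $\zeta$, such that for all $\underline{\mathbf u}\in L^\infty(\mathbb R;\mathbb R^2)$ with $\|\underline{\mathbf u}\|_{L^\infty}\le\rho$ the set $$\Omega=\{\lambda\in\mathbb C:|\mathrm{Re}(\lambda)|\ge\eta_1\}\cup\{\lambda\in\mathbb C:|\mathrm{Im}(\lambda)|\ge\eta_2,\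 \mathrm{Re}(\lambda)\ne0\}$$ belongs to the resolvent set of $\mathcal L(\underline{\mathbf u})$, i.e. $\sigma(\mathcal L(\underline{\mathbf u}))\cap\Omega=\emptyset$. -/

import Mathlib

open MeasureTheory TemperedDistribution
open scoped SchwartzMap LineDeriv ENNReal

noncomputable section

namespace LLE

/-! ## Resolvent set and spectrum of an unbounded operator -/

/-- The resolvent set of an unbounded operator `T : D(T) ⊆ E → E`: those `z` for which
`T - z : D(T) → E` is bijective with a bounded (everywhere defined) inverse `R`. -/
def resolventSet {E : Type*} [NormedAddCommGroup E] [NormedSpace ℂ E] (T : E →ₗ.[ℂ] E) : Set ℂ :=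
  {z | ∃ R : E →L[ℂ] E,
    (∀ y : E, ∃ h : R y ∈ T.domain, T ⟨R y, h⟩ - z • R y = y) ∧
    (∀ x : T.domain, R (T x - z • (x : E)) = x)}

/-- The spectrum of an unbounded operator. -/
def spectrum {E : Type*} [NormedAddCommGroup E] [NormedSpace ℂ E] (T : E →ₗ.[ℂ] E) : Set ℂ :=
  (resolventSet T)ᶜ

/-! ## Function spaces -/

/-- `L²(ℝ)`: square integrable functions on `ℝ` with values in `ℂ²` (Euclidean norm). -/
abbrev L2 : Type := Lp (EuclideanSpace ℂ (Fin 2)) 2 (volume : Measure ℝ)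

/-- `L^∞(ℝ)` with values in `ℝ²` (Euclidean norm). -/
abbrev LInf : Type := Lp (EuclideanSpace ℝ (Fin 2)) ∞ (volume : Measure ℝ)

/-- The Sobolev space `H²(ℝ)` as a subspace of `L²(ℝ)`. -/
def H2 : Submodule ℂ L2 where
  carrier := {w | MemSobolev 2 2 (w : 𝓢'(ℝ, EuclideanSpace ℂ (Fin 2)))}
  add_mem' {v w} hv hw := by
    have h := MemSobolev.add hv hw
    simp only [← Lp.toTemperedDistributionCLM_apply, ← map_add] at h
    exact h
  zero_mem' := by
    have h := memSobolev_fun_zero ℝ (EuclideanSpace ℂ (Fin 2)) 2 2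
    rw [← map_zero (Lp.toTemperedDistributionCLM (EuclideanSpace ℂ (Fin 2))
      (volume : Measure ℝ) 2)] at h
    exact h
  smul_mem' c {w} hw := by
    have h := MemSobolev.smul c hw
    simp only [← Lp.toTemperedDistributionCLM_apply, ← map_smul] at h
    exact h

/-- The second distributional derivative of an `H²` function is an `L²` function. -/
theorem exists_secondDeriv (w : H2) : ∃ g : L2,
    ∂_{(1 : ℝ)} (∂_{(1 : ℝ)} ((w : L2) : 𝓢'(ℝ, EuclideanSpace ℂ (Fin 2)))) = g := by
  have h : MemSobolev 2 2 ((w : L2) : 𝓢'(ℝ, EuclideanSpace ℂ (Fin 2))) := w.2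
  have h2 := (h.lineDerivOp (m := (1 : ℝ))).lineDerivOp (m := (1 : ℝ))
  norm_num at h2
  exact memSobolev_zero_iff.mp h2

/-- An `L²` function is determined by the distribution it defines. -/
theorem toTemperedDistribution_injective {f g : L2}
    (h : (f : 𝓢'(ℝ, EuclideanSpace ℂ (Fin 2))) = g) : f = g :=
  LinearMap.ker_eq_bot.mp (Lp.ker_toTemperedDistributionCLM_eq_bot
    (F := EuclideanSpace ℂ (Fin 2)) (μ := (volume : Measure ℝ)) (p := 2)) h

/-- The operator `∂ₓ² : H²(ℝ) → L²(ℝ)`: the `L²` function that represents the second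
distributional derivative. -/
def secondDeriv : H2 →ₗ[ℂ] L2 where
  toFun w := (exists_secondDeriv w).choose
  map_add' v w := by
    apply toTemperedDistribution_injective
    rw [← (exists_secondDeriv (v + w)).choose_spec]
    have h := congrArg₂ (· + ·) (exists_secondDeriv v).choose_spec
      (exists_secondDeriv w).choose_spec
    simp only [← Lp.toTemperedDistributionCLM_apply] at h ⊢
    rw [map_add, ← h, Submodule.coe_add, map_add, LineDeriv.lineDerivOp_add,
      LineDeriv.lineDerivOp_add]
  map_smul' c w := by
    apply toTemperedDistribution_injective
    rw [← (exists_secondDeriv (c • w)).choose_spec]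
    have h := congrArg (c • ·) (exists_secondDeriv w).choose_spec
    simp only [← Lp.toTemperedDistributionCLM_apply] at h ⊢
    rw [RingHom.id_apply, map_smul, ← h, Submodule.coe_smul, map_smul, LineDeriv.lineDerivOp_smul,
      LineDeriv.lineDerivOp_smul]

theorem secondDeriv_spec (w : H2) :
    ∂_{(1 : ℝ)} (∂_{(1 : ℝ)} ((w : L2) : 𝓢'(ℝ, EuclideanSpace ℂ (Fin 2)))) =
      (secondDeriv w : L2) :=
  (exists_secondDeriv w).choose_spec

/-! ## The linearization -/

/-- The matrix `J = (0 1; -1 0)`. -/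
def J : Matrix (Fin 2) (Fin 2) ℂ := !![0, 1; -1, 0]

/-- The symmetric matrix
`(3 v₁² + v₂², 2 v₁ v₂; 2 v₁ v₂, v₁² + 3 v₂²)` for `v = (v₁, v₂) ∈ ℝ²`. -/
def potential (v : EuclideanSpace ℝ (Fin 2)) : Matrix (Fin 2) (Fin 2) ℂ :=
  (!![3 * v 0 ^ 2 + v 1 ^ 2, 2 * v 0 * v 1;
      2 * v 0 * v 1, v 0 ^ 2 + 3 * v 1 ^ 2] : Matrix (Fin 2) (Fin 2) ℝ).map Complex.ofReal

/-- A complex `2 × 2` matrix as an operator on `ℂ²`. -/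
def matCLM (M : Matrix (Fin 2) (Fin 2) ℂ) :
    EuclideanSpace ℂ (Fin 2) →L[ℂ] EuclideanSpace ℂ (Fin 2) :=
  Matrix.toEuclideanCLM (𝕜 := ℂ) M

theorem continuous_potential : Continuous fun v => matCLM (potential v) := by
  have h1 : Continuous (Matrix.toEuclideanCLM (𝕜 := ℂ) (n := Fin 2)) :=
    (Matrix.toEuclideanCLM (𝕜 := ℂ) (n := Fin 2)).toAlgEquiv.toLinearMap.continuous_of_finiteDimensional
  refine h1.comp ?_
  refine continuous_matrix fun i j => ?_
  fin_cases i <;> fin_cases j <;> simp [potential] <;> fun_prop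

/-- For `u ∈ L^∞` and `w ∈ L²` the pointwise product of the potential with `w` is in `L²`. -/
theorem memLp_potential (u : LInf) (w : L2) :
    MemLp (fun x => matCLM (potential (u x)) (w x)) 2 (volume : Measure ℝ) := by
  obtain ⟨C, hC⟩ := (isCompact_closedBall (0 : EuclideanSpace ℝ (Fin 2)) (lpNorm u ∞ volume)).exists_bound_of_continuousOn
    continuous_potential.continuousOn
  refine (Lp.memLp w).of_le_mul (c := C) ?_ ?_
  · exact isBoundedBilinearMap_apply.continuous.comp_aestronglyMeasurable₂
      (continuous_potential.comp_aestronglyMeasurable (Lp.aestronglyMeasurable u))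
      (Lp.aestronglyMeasurable w)
  · filter_upwards [ae_le_lpNorm_exponent_top (Lp.memLp u)] with x hx
    exact (matCLM (potential (u x))).le_of_opNorm_le (hC _ (by simpa using hx)) _

/-- Multiplication by the potential, as an operator on `L²(ℝ)`. -/
def mulPotential (u : LInf) : L2 →ₗ[ℂ] L2 where
  toFun w := (memLp_potential u w).toLp _
  map_add' v w := by
    rw [← MemLp.toLp_add]
    apply MemLp.toLp_congr
    filter_upwards [Lp.coeFn_add v w] with x hx
    rw [hx]
    simp
  map_smul' c w := by
    rw [RingHom.id_apply, ← MemLp.toLp_const_smul]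
    apply MemLp.toLp_congr
    filter_upwards [Lp.coeFn_smul c w] with x hx
    rw [hx]
    simp

/-- The operator `L(u) = -∂ₓ² + ζ - potential(u)` on `L²(ℝ)` with domain `H²(ℝ)`. -/
def opL (ζ : ℝ) (u : LInf) : L2 →ₗ.[ℂ] L2 where
  domain := H2
  toFun := -secondDeriv + (ζ : ℂ) • H2.subtype - (mulPotential u).comp H2.subtype

/-- The operator `𝓛(u) = J L(u)` on `L²(ℝ)` with domain `H²(ℝ)`. -/
def linearization (ζ : ℝ) (u : LInf) : L2 →ₗ.[ℂ] L2 :=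
  ((matCLM J).compLpL 2 (volume : Measure ℝ)).toLinearMap.compPMap (opL ζ u)

end LLE

end

/-!
The operator is `J (S + ζ - V) - z`, where `S = -∂ₓ²` on `H²` is symmetric, nonnegative and commutes
with the skew isometry `J`, `J² = -1`, and where `V` is a bounded symmetric operator with norm at
most `C = 3 ρ²`.  Only these properties are used; they are collected in `IsHamiltonianPair` and the
abstract result is `exists_resolvent`.

*Lower bounds.*  As `J S` is skew, `‖f‖ ≥ (|Re z| - C) ‖w‖` for `f = (J (S + ζ - V) - z) w`
(`norm_ge_of_re`), which serves for large `|Re z|`.  For large `|Im z|` two facts are combined.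
The component `p` of `w` in the eigenspace `J = s i`, with the sign `s = -sgn (Im z)`, satisfies
`(S + ζ + |Im z|) p = …`; the operator on the left is at least `|Im z| - |ζ|`, so `p` is small
compared with `‖f‖ + C ‖w‖` (`norm_proj_le`).  On the other hand, pairing with `J w` and using the
symmetry of `S + ζ - V` gives `|Re z| |⟪J w, w⟫| ≤ ‖w‖ ‖f‖` (`re_mul_inner_le`), and `|⟪J w, w⟫|` is
the difference of the squared norms of the two eigencomponents of `w`.  If `Re z ≠ 0` and `f` is
small, both components are therefore small, whence `‖f‖ ≥ c ‖w‖` with `c` depending on a lower bound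
of `|Re z|` only (`norm_ge_of_im`).

*Surjectivity* comes from the method of continuity (`surjective_add_of_bound`): along a segment of
bounded perturbations with a uniform lower bound, surjectivity at one end gives surjectivity at the
other.  The starting point is `J (S + b)` with `b = (2π)²`, and the segments lead to
`J (S + b) - Re z`, then, for `|Re z| ≥ C + 1`, to `J (S + ζ - V) - z`, and finally, along horizontal
lines in the region of large `|Im z|`, to the remaining `z`.

The properties of `S` are read off on the Fourier side.  The Bessel potential of order two is
`1 - (2π)⁻² ∂ₓ²`, which maps `H²` onto `L²`, and its inverse is the Fourier multiplier with
the symbol `(1 + x²)⁻¹`, which is real and takes values in `(0, 1]`.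
-/

namespace LLE

open scoped InnerProductSpace FourierTransform

/-! ### The method of continuity -/

section Continuity

variable {E : Type*} [NormedAddCommGroup E] [NormedSpace ℂ E] {D : Submodule ℂ E}

theorem exists_bounded_inverse (T : D →ₗ[ℂ] E) {c : ℝ} (hc : 0 < c)
    (hb : ∀ w : D, c * ‖(w : E)‖ ≤ ‖T w‖) (hs : Function.Surjective T) :
    ∃ R : E →L[ℂ] E, (∀ y, ∃ h : R y ∈ D, T ⟨R y, h⟩ = y) ∧ (∀ x : D, R (T x) = x) ∧
      ∀ y, ‖R y‖ ≤ c⁻¹ * ‖y‖ := by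
  have hinj : Function.Injective T := by
    rw [injective_iff_map_eq_zero]
    intro w hw
    have h := hb w
    rw [hw, norm_zero] at h
    have h0 : ‖(w : E)‖ = 0 := le_antisymm (by nlinarith [norm_nonneg (w : E)]) (norm_nonneg _)
    exact Subtype.ext (norm_eq_zero.mp h0)
  let e := LinearEquiv.ofBijective T ⟨hinj, hs⟩
  have he : ∀ y, T (e.symm y) = y := fun y => e.apply_symm_apply y
  have hbd : ∀ y, ‖(D.subtype ∘ₗ e.symm.toLinearMap) y‖ ≤ c⁻¹ * ‖y‖ := by
    intro y
    have h := hb (e.symm y)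
    rw [he] at h
    rw [inv_mul_eq_div, le_div_iff₀ hc, mul_comm]
    exact h
  refine ⟨LinearMap.mkContinuous (D.subtype ∘ₗ e.symm.toLinearMap) c⁻¹ hbd, ?_, ?_, hbd⟩
  · intro y
    exact ⟨(e.symm y).2, he y⟩
  · intro x
    exact congrArg Subtype.val (e.symm_apply_apply x)

/-- A perturbation smaller than the lower bound of `T` preserves surjectivity (Neumann series). -/
theorem surjective_add_of_norm_lt [CompleteSpace E] (T : D →ₗ[ℂ] E) (K : E →L[ℂ] E) {c : ℝ}
    (hb : ∀ w : D, c * ‖(w : E)‖ ≤ ‖T w‖) (hK : ‖K‖ < c) (hs : Function.Surjective T) :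
    Function.Surjective (T + K.toLinearMap ∘ₗ D.subtype) := by
  have hc : 0 < c := (norm_nonneg K).trans_lt hK
  obtain ⟨R, hR, -, hn⟩ := exists_bounded_inverse T hc hb hs
  have hKR : ‖-(K * R)‖ < 1 := by
    rw [norm_neg]
    have hR' : ‖R‖ ≤ c⁻¹ := R.opNorm_le_bound (by positivity) hn
    calc ‖K * R‖ ≤ ‖K‖ * ‖R‖ := norm_mul_le _ _
      _ ≤ ‖K‖ * c⁻¹ := by gcongr
      _ < 1 := by rwa [mul_inv_lt_iff₀ hc, one_mul]
  obtain ⟨B, hB⟩ := (isUnit_one_sub_of_norm_lt_one hKR).exists_right_inv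
  intro y
  obtain ⟨h, hTy⟩ := hR (B y)
  refine ⟨⟨R (B y), h⟩, ?_⟩
  have h2 := congrArg (fun A : E →L[ℂ] E => A y) hB
  simp only [sub_neg_eq_add, mul_apply_eq_comp,
    add_apply, one_apply_eq_self] at h2
  simp only [LinearMap.add_apply, hTy, LinearMap.comp_apply, Submodule.subtype_apply,
    ContinuousLinearMap.coe_coe]
  exact h2

/-- The method of continuity: if `T + t K` is bounded below uniformly in `t ∈ [0, 1]` and `T` is
surjective, then so is `T + K`. -/
theorem surjective_add_of_bound [CompleteSpace E] (T : D →ₗ[ℂ] E) (K : E →L[ℂ] E) {c : ℝ}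
    (hc : 0 < c)
    (hb : ∀ t : ℝ, 0 ≤ t → t ≤ 1 → ∀ w : D, c * ‖(w : E)‖ ≤ ‖T w + (t : ℂ) • K w‖)
    (hs : Function.Surjective T) :
    Function.Surjective (T + K.toLinearMap ∘ₗ D.subtype) := by
  -- in `N` steps of size `‖K‖ / N < c`, each of which is a small perturbation
  obtain ⟨N, hN⟩ := exists_nat_gt (‖K‖ / c)
  have hN0 : (0 : ℝ) < N := lt_of_le_of_lt (by positivity) hN
  have key : ∀ k : ℕ, k ≤ N → Function.Surjective
      (T + ((((k / N : ℝ) : ℂ) • K).toLinearMap ∘ₗ D.subtype)) := by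
    intro k
    induction k with
    | zero =>
      intro _
      convert hs
      ext w
      simp
    | succ k ih =>
      intro hk
      have h := surjective_add_of_norm_lt (T + ((((k / N : ℝ) : ℂ) • K).toLinearMap ∘ₗ D.subtype))
        (((1 / N : ℝ) : ℂ) • K) (c := c) ?_ ?_ (ih (by omega))
      · convert h using 2
        ext w
        simp [add_assoc, ← add_smul, add_div]
      · intro w
        have hkN : (k : ℝ) ≤ N := by exact_mod_cast (Nat.le_succ k).trans hk
        exact hb (k / N) (by positivity) (by rwa [div_le_one hN0]) w
      · rw [norm_smul, Complex.norm_real, Real.norm_of_nonneg (by positivity), one_div,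
          inv_mul_lt_iff₀ hN0]
        rwa [div_lt_iff₀ hc] at hN
  have h := key N le_rfl
  rw [div_self hN0.ne', Complex.ofReal_one, one_smul] at h
  exact h

end Continuity

/-! ### Lower bounds and resolvents for Hamiltonian operators -/

section Hamiltonian

variable {E : Type*} [NormedAddCommGroup E] [InnerProductSpace ℂ E] {D : Submodule ℂ E}

/-- A symmetric nonnegative operator `S` with domain `D`, together with a bounded operator `J` that
is skew, squares to `-1`, preserves `D` and commutes with `S`.  Self-adjointness of `S` is not
included; where it matters, surjectivity of some `S + b` with `b > 0` is assumed separately. -/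
structure IsHamiltonianPair (S : D →ₗ[ℂ] E) (J : E →L[ℂ] E) : Prop where
  symm : ∀ v w : D, ⟪S v, (w : E)⟫_ℂ = ⟪(v : E), S w⟫_ℂ
  nonneg : ∀ w : D, 0 ≤ (⟪(w : E), S w⟫_ℂ).re
  mem : ∀ w ∈ D, J w ∈ D
  comm : ∀ w : D, S ⟨J w, mem w w.2⟩ = J (S w)
  skew : ∀ v w : E, ⟪J v, w⟫_ℂ = -⟪v, J w⟫_ℂ
  sq : ∀ v, J (J v) = -v

theorem inner_self_eq_ofReal (v : E) : ⟪v, v⟫_ℂ = ((‖v‖ ^ 2 : ℝ) : ℂ) := by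
  rw [inner_self_eq_norm_sq_to_K]
  simp

namespace IsHamiltonianPair

variable {S : D →ₗ[ℂ] E} {J : E →L[ℂ] E} (h : IsHamiltonianPair S J)
include h

theorem inner_J_J (v w : E) : ⟪J v, J w⟫_ℂ = ⟪v, w⟫_ℂ := by
  rw [h.skew, h.sq, inner_neg_right, neg_neg]

theorem norm_J (v : E) : ‖J v‖ = ‖v‖ := by
  have h1 := congrArg Complex.re (h.inner_J_J v v)
  rw [← sq_eq_sq₀ (norm_nonneg _) (norm_nonneg _)]
  have e := @inner_self_eq_norm_sq ℂ E _ _ _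
  simp only [RCLike.re_to_complex] at e
  rwa [e, e] at h1

theorem inner_J_self_re (v : E) : (⟪v, J v⟫_ℂ).re = 0 := by
  have h1 := congrArg Complex.re (h.skew v v)
  rw [← inner_conj_symm, Complex.conj_re, Complex.neg_re] at h1
  linarith

theorem inner_S_im (w : D) : (⟪(w : E), S w⟫_ℂ).im = 0 := by
  have h1 := congrArg Complex.im (h.symm w w)
  rw [← inner_conj_symm, Complex.conj_im] at h1
  linarith

theorem inner_J_S_re (w : D) : (⟪(w : E), J (S w)⟫_ℂ).re = 0 := by
  have h1 := congrArg Complex.re (h.symm w ⟨J w, h.mem w w.2⟩)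
  have h2 := congrArg Complex.re (h.skew w (S w))
  rw [h.comm] at h1
  rw [← inner_conj_symm, Complex.conj_re] at h1
  simp only [Complex.neg_re] at h2
  linarith

variable {V : E →L[ℂ] E} {C : ℝ}

/-- The lower bound for large `|Re z|`: pairing with `w` eliminates the skew part `J (S + a)`. -/
theorem norm_ge_of_re (hV : ∀ v, ‖V v‖ ≤ C * ‖v‖) (a : ℝ) (z : ℂ) (w : D) :
    (|z.re| - C) * ‖(w : E)‖ ≤ ‖J (S w + (a : ℂ) • (w : E) - V w) - z • (w : E)‖ := by
  set f := J (S w + (a : ℂ) • (w : E) - V w) - z • (w : E) with hf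
  rcases (norm_nonneg (w : E)).eq_or_lt with h0 | h0
  · rw [← h0, mul_zero]; exact norm_nonneg _
  have e : (⟪(w : E), f⟫_ℂ).re = -(⟪(w : E), J (V w)⟫_ℂ).re - z.re * ‖(w : E)‖ ^ 2 := by
    rw [hf]
    simp only [map_sub, map_add, map_smul, inner_sub_right, inner_add_right, inner_smul_right,
      Complex.sub_re, Complex.add_re, Complex.mul_re, h.inner_J_S_re, h.inner_J_self_re,
      Complex.ofReal_re, Complex.ofReal_im, inner_self_eq_ofReal]
    simp [-Complex.ofReal_pow]
  have h1 : |(⟪(w : E), f⟫_ℂ).re| ≤ ‖(w : E)‖ * ‖f‖ :=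
    (Complex.abs_re_le_norm _).trans (norm_inner_le_norm _ _)
  have h2 : |(⟪(w : E), J (V w)⟫_ℂ).re| ≤ ‖(w : E)‖ * (C * ‖(w : E)‖) := by
    refine (Complex.abs_re_le_norm _).trans ((norm_inner_le_norm _ _).trans ?_)
    rw [h.norm_J]
    gcongr
    exact hV w
  have h3 : |z.re| * ‖(w : E)‖ ^ 2 ≤ ‖(w : E)‖ * ‖f‖ + ‖(w : E)‖ * (C * ‖(w : E)‖) := by
    rw [← abs_of_nonneg (sq_nonneg ‖(w : E)‖), ← abs_mul]
    have : z.re * ‖(w : E)‖ ^ 2 = -(⟪(w : E), f⟫_ℂ).re - (⟪(w : E), J (V w)⟫_ℂ).re := by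
      rw [e]; ring
    rw [this]
    refine (abs_sub _ _).trans ?_
    rw [abs_neg]
    exact add_le_add h1 h2
  nlinarith

/-- A lower bound uniform in the real spectral parameter: pairing with `J w` leaves `S + a`. -/
theorem norm_ge_of_real (a r : ℝ) (w : D) :
    a * ‖(w : E)‖ ≤ ‖J (S w + (a : ℂ) • (w : E)) - (r : ℂ) • (w : E)‖ := by
  set f := J (S w + (a : ℂ) • (w : E)) - (r : ℂ) • (w : E) with hf
  rcases (norm_nonneg (w : E)).eq_or_lt with h0 | h0
  · rw [← h0, mul_zero]; exact norm_nonneg _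
  have h3 : (⟪J (w : E), (w : E)⟫_ℂ).re = 0 := by
    rw [h.skew, Complex.neg_re, h.inner_J_self_re, neg_zero]
  have e : (⟪J (w : E), f⟫_ℂ).re = (⟪(w : E), S w⟫_ℂ).re + a * ‖(w : E)‖ ^ 2 := by
    rw [hf]
    simp only [inner_sub_right, h.inner_J_J, inner_add_right, inner_smul_right,
      Complex.sub_re, Complex.add_re, Complex.mul_re, h3,
      Complex.ofReal_re, Complex.ofReal_im, inner_self_eq_ofReal]
    simp [-Complex.ofReal_pow]
  have h1 : (⟪J (w : E), f⟫_ℂ).re ≤ ‖(w : E)‖ * ‖f‖ := by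
    refine (Complex.re_le_norm _).trans ((norm_inner_le_norm _ _).trans ?_)
    rw [h.norm_J]
  nlinarith [h.nonneg w]

/-- The vector `w - s i J w`, with `s = ±1`, is twice the component of `w` in the eigenspace of `J`
for the eigenvalue `s i`.  For `s = -sgn (Im z)` it is controlled by `‖f‖` and `‖w‖`, where `f` is
the image of `w`, since there `s i (S + a) - z` has imaginary part `s (S + a + |Im z|)`. -/
theorem norm_proj_le (hV : ∀ v, ‖V v‖ ≤ C * ‖v‖) (a : ℝ) (z : ℂ) (s : ℝ) (hs : s ^ 2 = 1)
    (hsz : s * z.im = -|z.im|) (w : D) :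
    (|z.im| - |a|) * ‖(w : E) - (s * Complex.I) • J w‖ ≤
      2 * (‖J (S w + (a : ℂ) • (w : E) - V w) - z • (w : E)‖ + C * ‖(w : E)‖) := by
  set f := J (S w + (a : ℂ) • (w : E) - V w) - z • (w : E) with hf
  set p : D := w - (s * Complex.I) • ⟨J w, h.mem w w.2⟩ with hp
  have hpw : (p : E) = (w : E) - (s * Complex.I) • J w := by simp [hp]
  have hs' : (s : ℂ) * s = 1 := by exact_mod_cast (pow_two s).symm.trans hs
  have hsI : ((s : ℂ) * Complex.I) * (s * Complex.I) = -1 := by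
    linear_combination (-1 : ℂ) * hs' + (s : ℂ) ^ 2 * Complex.I_mul_I
  have hJp : J (p : E) = (s * Complex.I) • (p : E) := by
    rw [hpw, map_sub, map_smul, h.sq, smul_sub, smul_smul, hsI]
    module
  have hSp : S p = S w - (s * Complex.I) • J (S w) := by
    rw [hp, map_sub, map_smul, h.comm]
  have hJSp : J (S p) = (s * Complex.I) • S p := by
    rw [hSp, map_sub, map_smul, h.sq, smul_sub, smul_smul, hsI]
    module
  -- kept opaque, so that `g` stays an atom in the identities below
  obtain ⟨g, hg⟩ : ∃ g : E, g = f + J (V w) := ⟨_, rfl⟩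
  have hgn : ‖g‖ ≤ ‖f‖ + C * ‖(w : E)‖ := by
    rw [hg]
    refine (norm_add_le _ _).trans ?_
    rw [h.norm_J]
    gcongr
    exact hV w
  have hgw : g = J (S w) + (a : ℂ) • J (w : E) - z • (w : E) := by
    rw [hg, hf]
    simp only [map_sub, map_add, map_smul]
    module
  have hgp : g - (s * Complex.I) • J g =
      (s * Complex.I) • S p + ((a : ℂ) * (s * Complex.I) - z) • (p : E) := by
    have : g - (s * Complex.I) • J g =
        J (S p) + (a : ℂ) • J (p : E) - z • (p : E) := by
      rw [hgw, hSp, hpw]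
      simp only [map_sub, map_add, map_smul]
      module
    rw [this, hJSp, hJp]
    module
  have hs1 : |s| = 1 := by rw [← sq_eq_sq₀ (abs_nonneg _) zero_le_one, sq_abs, hs, one_pow]
  have hn2 : ‖g - (s * Complex.I) • J g‖ ≤ 2 * ‖g‖ := by
    refine (norm_sub_le _ _).trans ?_
    rw [norm_smul, h.norm_J, norm_mul, Complex.norm_I, Complex.norm_real, Real.norm_eq_abs, hs1]
    linarith
  have e : s * (⟪(p : E), g - (s * Complex.I) • J g⟫_ℂ).im =
      (⟪(p : E), S p⟫_ℂ).re + (a + |z.im|) * ‖(p : E)‖ ^ 2 := by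
    rw [hgp, inner_add_right, inner_smul_right, inner_smul_right, inner_self_eq_ofReal]
    simp only [Complex.add_im, Complex.mul_im, Complex.mul_re, Complex.I_re, Complex.I_im,
      Complex.ofReal_re, Complex.ofReal_im, Complex.sub_im, Complex.sub_re, h.inner_S_im]
    linear_combination ((⟪(p : E), S p⟫_ℂ).re + a * ‖(p : E)‖ ^ 2) * hs - ‖(p : E)‖ ^ 2 * hsz
  have hle : s * (⟪(p : E), g - (s * Complex.I) • J g⟫_ℂ).im ≤ ‖(p : E)‖ * (2 * ‖g‖) := by
    refine (le_abs_self _).trans ?_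
    rw [abs_mul, hs1, one_mul]
    refine (Complex.abs_im_le_norm _).trans ((norm_inner_le_norm _ _).trans ?_)
    gcongr
  rw [← hpw]
  rcases (norm_nonneg (p : E)).eq_or_lt with h0 | h0
  · rw [← h0, mul_zero]; linarith [norm_nonneg g]
  have := h.nonneg p
  have ha := neg_abs_le a
  have h5 : (|z.im| - |a|) * ‖(p : E)‖ ^ 2 ≤ ‖(p : E)‖ * (2 * ‖g‖) := by
    nlinarith [sq_nonneg ‖(p : E)‖]
  have h6 : (|z.im| - |a|) * ‖(p : E)‖ ≤ 2 * ‖g‖ := by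
    nlinarith
  linarith

/-- Pairing the image of `w` with `J w`, the terms with the symmetric operators `S`, `a`, `V` become
real, and the imaginary part retains only `z`. -/
theorem re_mul_inner_le (hVs : ∀ v w, ⟪V v, w⟫_ℂ = ⟪v, V w⟫_ℂ) (a : ℝ) (z : ℂ) (w : D) :
    |z.re| * |(⟪J (w : E), (w : E)⟫_ℂ).im| ≤
      ‖(w : E)‖ * ‖J (S w + (a : ℂ) • (w : E) - V w) - z • (w : E)‖ := by
  set f := J (S w + (a : ℂ) • (w : E) - V w) - z • (w : E) with hf
  have h3 : (⟪J (w : E), (w : E)⟫_ℂ).re = 0 := by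
    rw [h.skew, Complex.neg_re, h.inner_J_self_re, neg_zero]
  have hV0 : (⟪(w : E), V w⟫_ℂ).im = 0 := by
    have h1 := congrArg Complex.im (hVs w w)
    rw [← inner_conj_symm, Complex.conj_im] at h1
    linarith
  have e : (⟪J (w : E), f⟫_ℂ).im = -(z.re * (⟪J (w : E), (w : E)⟫_ℂ).im) := by
    rw [hf]
    simp only [inner_sub_right, h.inner_J_J, inner_add_right, inner_smul_right,
      Complex.sub_im, Complex.add_im, Complex.mul_im, h3, h.inner_S_im, hV0,
      Complex.ofReal_re, Complex.ofReal_im, inner_self_eq_ofReal]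
    simp [-Complex.ofReal_pow]
  rw [← abs_mul, ← abs_neg, ← e]
  refine (Complex.abs_im_le_norm _).trans ((norm_inner_le_norm _ _).trans ?_)
  rw [h.norm_J]

/-- The lower bound for large `|Im z|` away from the imaginary axis.  One eigencomponent of `w` is
small by `norm_proj_le`, and the two have almost the same norm by `re_mul_inner_le`. -/
theorem norm_ge_of_im (hVs : ∀ v w, ⟪V v, w⟫_ℂ = ⟪v, V w⟫_ℂ) (hC : 0 ≤ C)
    (hV : ∀ v, ‖V v‖ ≤ C * ‖v‖) (a : ℝ) (z : ℂ) {r : ℝ} (hr : 0 < r) (hz : r ≤ |z.re|)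
    (hi : |a| + 4 * C + 4 ≤ |z.im|) (w : D) :
    min (1 / 2) (r / 2) * ‖(w : E)‖ ≤ ‖J (S w + (a : ℂ) • (w : E) - V w) - z • (w : E)‖ := by
  obtain ⟨s, hs, hsz⟩ : ∃ s : ℝ, s ^ 2 = 1 ∧ s * z.im = -|z.im| := by
    rcases le_total 0 z.im with h0 | h0
    · exact ⟨-1, by norm_num, by rw [abs_of_nonneg h0]; ring⟩
    · exact ⟨1, by norm_num, by rw [abs_of_nonpos h0]; ring⟩
  have h1 := h.norm_proj_le hV a z s hs hsz w
  have h2 := h.re_mul_inner_le hVs a z w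
  set f := J (S w + (a : ℂ) • (w : E) - V w) - z • (w : E) with hf
  have hp : ‖(w : E) - (s * Complex.I) • J w‖ ^ 2 =
      2 * ‖(w : E)‖ ^ 2 - 2 * s * (⟪J (w : E), (w : E)⟫_ℂ).im := by
    have e := @norm_sub_sq ℂ E _ _ _ (w : E) ((s * Complex.I) • J (w : E))
    have hns : ‖(s * Complex.I) • J (w : E)‖ ^ 2 = ‖(w : E)‖ ^ 2 := by
      rw [norm_smul, h.norm_J, norm_mul, Complex.norm_I, Complex.norm_real, mul_one, mul_pow,
        Real.norm_eq_abs, sq_abs, hs, one_mul]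
    have hre : RCLike.re ⟪(w : E), (s * Complex.I) • J (w : E)⟫_ℂ =
        s * (⟪J (w : E), (w : E)⟫_ℂ).im := by
      rw [inner_smul_right, h.skew]
      simp
    rw [e, hns, hre]
    ring
  set k := (⟪J (w : E), (w : E)⟫_ℂ).im
  have hs1 : |s| = 1 := by rw [← sq_eq_sq₀ (abs_nonneg _) zero_le_one, sq_abs, hs, one_pow]
  have hsk : s * k ≤ |k| := by
    calc s * k ≤ |s * k| := le_abs_self _
      _ = |k| := by rw [abs_mul, hs1, one_mul]
  set n := ‖(w : E)‖
  set F := ‖f‖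
  set P := ‖(w : E) - (s * Complex.I) • J w‖
  have hn : 0 ≤ n := norm_nonneg _
  have hF : 0 ≤ F := norm_nonneg _
  have hP : 0 ≤ P := norm_nonneg _
  have hP2 : P ≤ (F + n) / 2 := by
    have : (4 * C + 4) * P ≤ 2 * (F + C * n) :=
      (mul_le_mul_of_nonneg_right (by linarith) hP).trans h1
    have h3 : (4 * C + 4) * P ≤ (4 * C + 4) * ((F + n) / 2) := by nlinarith
    exact le_of_mul_le_mul_left h3 (by positivity)
  by_contra! hlt
  have hn0 : 0 < n := by
    rcases hn.eq_or_lt with h0 | h0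
    · rw [← h0, mul_zero] at hlt; linarith
    · exact h0
  have hF1 : F < n / 2 := hlt.trans_le (by nlinarith [min_le_left (1 / 2 : ℝ) (r / 2)])
  have hF2 : F < r / 2 * n := hlt.trans_le (by nlinarith [min_le_right (1 / 2 : ℝ) (r / 2)])
  have hk : |k| ≤ n ^ 2 / 2 := by
    have : r * |k| ≤ r * (n ^ 2 / 2) := by
      calc r * |k| ≤ |z.re| * |k| := by gcongr
        _ ≤ n * F := h2
        _ ≤ n * (r / 2 * n) := by gcongr
        _ = _ := by ring
    exact le_of_mul_le_mul_left this hr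
  have hPn : P ≤ 3 / 4 * n := by linarith
  nlinarith [mul_self_le_mul_self hP hPn]

end IsHamiltonianPair

/-- The operator `J (S + a - V) - z` has a bounded inverse when `|Re z|` is large, or when `|Im z|`
is large and `Re z ≠ 0`. -/
theorem exists_resolvent [CompleteSpace E] {S : D →ₗ[ℂ] E} {J V : E →L[ℂ] E} {C : ℝ}
    (h : IsHamiltonianPair S J) {b : ℝ} (hb : 0 < b)
    (hS : ∀ y, ∃ w : D, S w + (b : ℂ) • (w : E) = y)
    (hVs : ∀ v w, ⟪V v, w⟫_ℂ = ⟪v, V w⟫_ℂ) (hC : 0 ≤ C) (hV : ∀ v, ‖V v‖ ≤ C * ‖v‖) (a : ℝ)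
    {z : ℂ} (hz : C + 1 ≤ |z.re| ∨ (|a| + 4 * C + 4 ≤ |z.im| ∧ z.re ≠ 0)) :
    ∃ R : E →L[ℂ] E,
      (∀ y, ∃ hy : R y ∈ D, J (S ⟨R y, hy⟩ + (a : ℂ) • R y - V (R y)) - z • R y = y) ∧
      ∀ x : D, R (J (S x + (a : ℂ) • (x : E) - V x) - z • (x : E)) = x := by
  -- real spectral parameter, no potential
  have s1 : ∀ r : ℝ, Function.Surjective
      (J.toLinearMap ∘ₗ (S + (b : ℂ) • D.subtype) - (r : ℂ) • D.subtype) := by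
    intro r
    have := surjective_add_of_bound (J.toLinearMap ∘ₗ (S + (b : ℂ) • D.subtype))
      ((-r : ℂ) • ContinuousLinearMap.id ℂ E) hb ?_ ?_
    · convert this using 2
      ext w
      simp [sub_eq_add_neg]
    · intro t _ _ w
      convert h.norm_ge_of_real b (t * r) w using 2
      simp [sub_eq_add_neg, smul_smul, -Complex.coe_smul]
    · intro y
      obtain ⟨w, hw⟩ := hS (-J y)
      refine ⟨w, ?_⟩
      change J (S w + (b : ℂ) • (w : E)) = y
      rw [hw, map_neg, h.sq, neg_neg]
  -- large real part: switch on the potential, the shift and the imaginary part simultaneously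
  have s2 : ∀ z : ℂ, C + 1 ≤ |z.re| → Function.Surjective
      (J.toLinearMap ∘ₗ (S + (a : ℂ) • D.subtype - V.toLinearMap ∘ₗ D.subtype) - z • D.subtype) := by
    intro z hz
    have := surjective_add_of_bound _
      (J ∘L (((a - b : ℝ) : ℂ) • ContinuousLinearMap.id ℂ E - V) -
        (z.im * Complex.I) • ContinuousLinearMap.id ℂ E) one_pos ?_ (s1 z.re)
    · convert this using 2
      ext w
      have hzz : z • (w : E) = (z.re : ℂ) • (w : E) + (z.im * Complex.I) • (w : E) := by
        rw [← add_smul, Complex.re_add_im]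
      simp [-Complex.coe_smul]
      rw [hzz]
      module
    · intro t ht0 ht1 w
      have hn : ∀ v, ‖((t : ℂ) • V) v‖ ≤ C * ‖v‖ := by
        intro v
        rw [smul_apply, norm_smul, Complex.norm_real, Real.norm_of_nonneg ht0]
        calc t * ‖V v‖ ≤ 1 * ‖V v‖ := by gcongr
          _ ≤ _ := by rw [one_mul]; exact hV v
      have := h.norm_ge_of_re hn (b + t * (a - b)) (z.re + t * z.im * Complex.I) w
      have h1 : 1 * ‖(w : E)‖ ≤
          (|((z.re : ℂ) + t * z.im * Complex.I).re| - C) * ‖(w : E)‖ := by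
        gcongr
        simp
        linarith
      refine (h1.trans this).trans_eq ?_
      congr 1
      simp
      module
  have hfin : ∀ c : ℝ, 0 < c → (∀ w : D,
        c * ‖(w : E)‖ ≤ ‖J (S w + (a : ℂ) • (w : E) - V w) - z • (w : E)‖) →
      Function.Surjective (J.toLinearMap ∘ₗ (S + (a : ℂ) • D.subtype - V.toLinearMap ∘ₗ D.subtype)
        - z • D.subtype) → _ := fun c hc hbd hs =>
    (exists_bounded_inverse (J.toLinearMap ∘ₗ
      (S + (a : ℂ) • D.subtype - V.toLinearMap ∘ₗ D.subtype) - z • D.subtype) hc hbd hs)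
  by_cases hz1 : C + 1 ≤ |z.re|
  · obtain ⟨R, hR1, hR2, -⟩ := hfin 1 one_pos (fun w => le_trans (by gcongr; linarith)
      (h.norm_ge_of_re hV a z w)) (s2 z hz1)
    exact ⟨R, hR1, hR2⟩
  · obtain ⟨hi, hr⟩ := hz.resolve_left hz1
    have hr0 := abs_pos.mpr hr
    have hc : 0 < min (1 / 2) (|z.re| / 2) := lt_min (by norm_num) (by positivity)
    push Not at hz1
    have hs : Function.Surjective (J.toLinearMap ∘ₗ
        (S + (a : ℂ) • D.subtype - V.toLinearMap ∘ₗ D.subtype) - z • D.subtype) := by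
      -- start from the point `q * Re z + i Im z` with real part `± (C + 1)` and the same
      -- imaginary part; `|Re|` stays at least `|Re z|` along the segment
      set q : ℝ := (C + 1) / |z.re| with hq
      have hq1 : 1 ≤ q := by rw [hq, one_le_div hr0]; exact hz1.le
      have := surjective_add_of_bound _
        ((((q - 1) * z.re : ℝ) : ℂ) • ContinuousLinearMap.id ℂ E) hc ?_
        (s2 ((q * z.re : ℝ) + z.im * Complex.I) ?_)
      · convert this using 2
        ext w
        have hzz : z • (w : E) = (z.re : ℂ) • (w : E) + (z.im * Complex.I) • (w : E) := by
          rw [← add_smul, Complex.re_add_im]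
        simp [-Complex.coe_smul]
        rw [hzz]
        module
      · intro t ht0 ht1 w
        have hz' : |z.re| ≤ |(((q - t * (q - 1)) * z.re : ℝ) + z.im * Complex.I : ℂ).re| := by
          simp [-Complex.ofReal_mul, -abs_mul]
          rw [abs_mul]
          have : 1 ≤ q - t * (q - 1) := by nlinarith
          nlinarith [le_abs_self (q - t * (q - 1))]
        refine (h.norm_ge_of_im hVs hC hV a (((q - t * (q - 1)) * z.re : ℝ) + z.im * Complex.I)
          hr0 hz' (by simpa using hi) w).trans_eq ?_
        congr 1
        simp
        module
      · simp [-Complex.ofReal_mul, -abs_mul]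
        rw [abs_mul, abs_of_nonneg (by linarith), hq, div_mul_cancel₀ _ hr0.ne']
    obtain ⟨R, hR1, hR2, -⟩ := hfin _ hc (fun w => h.norm_ge_of_im hVs hC hV a z hr0 le_rfl hi w) hs
    exact ⟨R, hR1, hR2⟩

end Hamiltonian

/-! ### The second derivative and the Fourier transform -/

/-- `ℂ²` with its Euclidean norm. -/
abbrev C2 := EuclideanSpace ℂ (Fin 2)

/-- A constant matrix acts on an `L²` function and on its distribution in the same way, so it commutes
with all operators on distributions that are defined by duality. -/
theorem toTemperedDistribution_compLpL (A : C2 →L[ℂ] C2) (w : L2) (φ : 𝓢(ℝ, ℂ)) :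
    ((A.compLpL 2 (volume : Measure ℝ) w : L2) : 𝓢'(ℝ, C2)) φ = A ((w : 𝓢'(ℝ, C2)) φ) := by
  have hint : Integrable (fun x => φ x • w x) (volume : Measure ℝ) := by
    rw [← memLp_one_iff_integrable]
    exact (Lp.memLp w).smul (φ.memLp 2 volume)
  rw [Lp.toTemperedDistribution_apply, Lp.toTemperedDistribution_apply,
    ← ContinuousLinearMap.integral_comp_comm A hint]
  apply integral_congr_ae
  filter_upwards [A.coeFn_compLpL w] with x hx
  rw [hx, map_smul]

theorem compLpL_mem_H2 (A : C2 →L[ℂ] C2) {w : L2} (hw : w ∈ H2) :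
    A.compLpL 2 (volume : Measure ℝ) w ∈ H2 := by
  obtain ⟨f, hf⟩ := hw
  refine ⟨A.compLpL 2 (volume : Measure ℝ) f, ?_⟩
  ext1 φ
  rw [toTemperedDistribution_compLpL, ← hf]
  simp only [besselPotential, fourierMultiplierCLM_apply_apply]
  rw [toTemperedDistribution_compLpL]

theorem secondDeriv_compLpL (A : C2 →L[ℂ] C2) (w : H2) :
    secondDeriv ⟨A.compLpL 2 (volume : Measure ℝ) w, compLpL_mem_H2 A w.2⟩ =
      A.compLpL 2 (volume : Measure ℝ) (secondDeriv w) := by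
  apply toTemperedDistribution_injective
  rw [← secondDeriv_spec]
  ext1 φ
  rw [toTemperedDistribution_compLpL, ← secondDeriv_spec]
  simp only [lineDerivOp_apply_apply]
  rw [toTemperedDistribution_compLpL]

theorem secondDeriv_eq_fourierMultiplier (w : H2) :
    ((secondDeriv w : L2) : 𝓢'(ℝ, C2)) = -((2 * Real.pi : ℝ) : ℂ) ^ 2 •
      fourierMultiplierCLM C2 (fun x : ℝ ↦ ((x ^ 2 : ℝ) : ℂ)) ((w : L2) : 𝓢'(ℝ, C2)) := by
  rw [← secondDeriv_spec]
  simp only [lineDeriv_eq_fourierMultiplierCLM, map_smul]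
  rw [fourierMultiplierCLM_fourierMultiplierCLM_apply (by fun_prop) (by fun_prop), smul_smul]
  congr 1
  · push_cast
    linear_combination (2 * (Real.pi : ℂ)) ^ 2 * Complex.I_mul_I
  · congr 2
    ext x
    simp [sq]

/-- The symbol `(1 + x²)⁻¹` of the inverse of the Bessel potential of order two. -/
noncomputable def resolventSymbol (x : ℝ) : ℂ := ((1 + x ^ 2 : ℝ) : ℂ)⁻¹

/-- The Bessel potential of order two as an operator `H² → L²`, that is `1 - (2π)⁻² ∂ₓ²`; the factor
comes from the normalization of the Fourier transform in Mathlib. -/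
noncomputable def besselTwo (w : H2) : L2 := (w : L2) - (((2 * Real.pi) ^ 2 : ℝ) : ℂ)⁻¹ • secondDeriv w

theorem besselPotential_two_eq (w : H2) :
    besselPotential ℝ C2 2 ((w : L2) : 𝓢'(ℝ, C2)) = (besselTwo w : 𝓢'(ℝ, C2)) := by
  have h1 : ((besselTwo w : L2) : 𝓢'(ℝ, C2)) = ((w : L2) : 𝓢'(ℝ, C2)) -
      (((2 * Real.pi) ^ 2 : ℝ) : ℂ)⁻¹ • ((secondDeriv w : L2) : 𝓢'(ℝ, C2)) := by
    simp only [← Lp.toTemperedDistributionCLM_apply, besselTwo, map_sub, map_smul]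
  have hpi : (((2 * Real.pi) ^ 2 : ℝ) : ℂ) ≠ 0 := by
    exact_mod_cast (by positivity : (2 * Real.pi) ^ 2 ≠ 0)
  rw [h1, secondDeriv_eq_fourierMultiplier, smul_smul]
  have h2 : (((2 * Real.pi) ^ 2 : ℝ) : ℂ)⁻¹ * -((2 * Real.pi : ℝ) : ℂ) ^ 2 = -1 := by
    rw [← Complex.ofReal_pow, mul_neg, inv_mul_cancel₀ hpi]
  have h3 : (fun x : ℝ ↦ (((1 + ‖x‖ ^ 2) ^ ((2 : ℝ) / 2) : ℝ) : ℂ)) =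
      (fun _ ↦ (1 : ℂ)) + fun x : ℝ ↦ ((x ^ 2 : ℝ) : ℂ) := by
    ext x
    simp
  rw [h2, besselPotential, h3, fourierMultiplierCLM_apply,
    smulLeftCLM_add (by fun_prop) (by fun_prop)]
  rw [fourierMultiplierCLM_apply]
  simp [FourierTransform.fourierInv_add]

theorem exists_besselTwo_eq (f : L2) : ∃ w : H2, besselTwo w = f := by
  have h2 : MemSobolev 2 2 (besselPotential ℝ C2 (-2) (f : 𝓢'(ℝ, C2))) := by
    rw [memSobolev_besselPotential_iff]
    norm_num
    exact memSobolev_zero_iff.mpr ⟨f, rfl⟩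
  obtain ⟨w, hw⟩ := memSobolev_zero_iff.mp (h2.mono (s' := 0) (by norm_num))
  have hw2 : w ∈ H2 := by
    change MemSobolev 2 2 (w : 𝓢'(ℝ, C2))
    rwa [← hw]
  refine ⟨⟨w, hw2⟩, toTemperedDistribution_injective ?_⟩
  rw [← besselPotential_two_eq, ← hw]
  simp

/-- The inverse of `besselTwo` is the Fourier multiplier with the symbol `resolventSymbol`. -/
theorem fourier_ae_eq (w : H2) :
    (𝓕 (w : L2) : L2) =ᵐ[volume] fun x => resolventSymbol x • (𝓕 (besselTwo w) : L2) x := by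
  have hg : resolventSymbol.HasTemperateGrowth := by
    have : resolventSymbol = fun x : ℝ ↦ (((1 + ‖x‖ ^ 2) ^ (-1 : ℝ) : ℝ) : ℂ) := by
      ext x
      simp [resolventSymbol, Real.rpow_neg_one]
    rw [this]
    fun_prop
  have hb : ∀ x, ‖resolventSymbol x‖ ≤ 1 := by
    intro x
    rw [resolventSymbol, norm_inv, Complex.norm_real, Real.norm_of_nonneg (by positivity)]
    exact inv_le_one_of_one_le₀ (by nlinarith [sq_nonneg x])
  have hm : MemLp resolventSymbol ∞ (volume : Measure ℝ) :=
    memLp_top_of_bound hg.1.continuous.aestronglyMeasurable 1 (Filter.Eventually.of_forall hb)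
  have key : (𝓕 (w : L2) : L2) = (hm.toLp _ • (𝓕 (besselTwo w) : L2) : L2) := by
    apply toTemperedDistribution_injective
    rw [Lp.toTemperedDistribution_smul_eq hg, ← Lp.fourier_toTemperedDistribution_eq,
      ← Lp.fourier_toTemperedDistribution_eq, ← besselPotential_two_eq,
      fourier_besselPotential_eq_smulLeftCLM_fourier_apply,
      smulLeftCLM_smulLeftCLM_apply (by fun_prop) hg]
    have : ((fun x : ℝ ↦ (((1 + ‖x‖ ^ 2) ^ ((2 : ℝ) / 2) : ℝ) : ℂ)) * resolventSymbol) =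
        fun _ ↦ (1 : ℂ) := by
      ext x
      have : ((1 + x ^ 2 : ℝ) : ℂ) ≠ 0 := by
        exact_mod_cast (by positivity : (1 + x ^ 2 : ℝ) ≠ 0)
      simp [resolventSymbol, -Complex.ofReal_add]
      exact mul_inv_cancel₀ this
    rw [this, smulLeftCLM_const, one_smul]
  rw [key]
  filter_upwards [Lp.coeFn_lpSMul (r := 2) (hm.toLp _) (𝓕 (besselTwo w) : L2), hm.coeFn_toLp]
    with x h1 h2
  rw [h1, Pi.smul_apply', h2]

theorem inner_besselTwo_symm (v w : H2) :
    ⟪besselTwo v, (w : L2)⟫_ℂ = ⟪(v : L2), besselTwo w⟫_ℂ := by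
  rw [← Lp.inner_fourier_eq, ← Lp.inner_fourier_eq (v : L2), L2.inner_def, L2.inner_def]
  apply integral_congr_ae
  filter_upwards [fourier_ae_eq v, fourier_ae_eq w] with x hv hw
  rw [hv, hw, inner_smul_left, inner_smul_right, resolventSymbol, ← Complex.ofReal_inv,
    Complex.conj_ofReal]

theorem inner_besselTwo_sub_nonneg (w : H2) : 0 ≤ (⟪(w : L2), besselTwo w - w⟫_ℂ).re := by
  have hsub : (𝓕 (besselTwo w - w) : L2) = 𝓕 (besselTwo w) - 𝓕 (w : L2) :=
    (Lp.fourierTransformₗᵢ ℝ C2).map_sub _ _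
  rw [← Lp.inner_fourier_eq, hsub, L2.inner_def, ← RCLike.re_to_complex,
    ← integral_re (L2.integrable_inner _ _)]
  apply integral_nonneg_of_ae
  filter_upwards [fourier_ae_eq w, Lp.coeFn_sub (𝓕 (besselTwo w) : L2) (𝓕 (w : L2))] with x hw hs
  rw [hs, Pi.sub_apply, hw]
  set f := (𝓕 (besselTwo w) : L2) x
  have hm : resolventSymbol x = (((1 + x ^ 2)⁻¹ : ℝ) : ℂ) := by simp [resolventSymbol]
  have h1 : (1 + x ^ 2)⁻¹ ≤ 1 := inv_le_one_of_one_le₀ (by nlinarith [sq_nonneg x])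
  rw [hm, inner_smul_left, inner_sub_right, inner_smul_right, inner_self_eq_ofReal,
    Complex.conj_ofReal, ← Complex.ofReal_mul, ← Complex.ofReal_sub, ← Complex.ofReal_mul]
  simp only [RCLike.re_to_complex, Complex.ofReal_re, Pi.zero_apply]
  have : 0 ≤ (1 + x ^ 2)⁻¹ := by positivity
  apply mul_nonneg this
  nlinarith [sq_nonneg ‖f‖]

theorem neg_secondDeriv_eq (w : H2) :
    (-secondDeriv) w = (((2 * Real.pi) ^ 2 : ℝ) : ℂ) • (besselTwo w - w) := by
  have hpi : (((2 * Real.pi) ^ 2 : ℝ) : ℂ) ≠ 0 := by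
    exact_mod_cast (by positivity : (2 * Real.pi) ^ 2 ≠ 0)
  rw [besselTwo, sub_sub_cancel_left, smul_neg, smul_smul, mul_inv_cancel₀ hpi, one_smul]
  rfl

theorem isHamiltonianPair : IsHamiltonianPair (-secondDeriv)
    ((matCLM J).compLpL 2 (volume : Measure ℝ)) where
  symm v w := by
    rw [neg_secondDeriv_eq, neg_secondDeriv_eq, inner_smul_left, inner_smul_right,
      inner_sub_left, inner_sub_right, inner_besselTwo_symm, Complex.conj_ofReal]
  nonneg w := by
    rw [neg_secondDeriv_eq, inner_smul_right, Complex.re_ofReal_mul]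
    exact mul_nonneg (by positivity) (inner_besselTwo_sub_nonneg w)
  mem w hw := compLpL_mem_H2 _ hw
  comm w := by
    rw [LinearMap.neg_apply, LinearMap.neg_apply, map_neg, secondDeriv_compLpL]
  skew v w := by
    rw [L2.inner_def, L2.inner_def, ← integral_neg]
    apply integral_congr_ae
    filter_upwards [(matCLM J).coeFn_compLpL v, (matCLM J).coeFn_compLpL w] with x hv hw
    rw [hv, hw]
    simp [matCLM, J, PiLp.inner_apply, Matrix.mulVec, dotProduct]
  sq v := by
    apply Lp.ext
    filter_upwards [(matCLM J).coeFn_compLpL v, (matCLM J).coeFn_compLpL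
      ((matCLM J).compLpL 2 (volume : Measure ℝ) v), Lp.coeFn_neg v] with x h1 h2 h3
    rw [h2, h1, h3, Pi.neg_apply]
    ext i
    fin_cases i <;> simp [matCLM, J, Matrix.mulVec, dotProduct]

/-! ### The potential -/

/-- The bound follows from `potential v w = |v|² w + 2 ⟪v, w⟫ v`. -/
theorem norm_matCLM_potential_le (v : EuclideanSpace ℝ (Fin 2)) (w : C2) :
    ‖matCLM (potential v) w‖ ≤ 3 * ‖v‖ ^ 2 * ‖w‖ := by
  let c : C2 := WithLp.toLp 2 fun i => (v i : ℂ)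
  have hc : ‖c‖ = ‖v‖ := by
    simp [c, EuclideanSpace.norm_eq]
  have e : matCLM (potential v) w = ((‖v‖ ^ 2 : ℝ) : ℂ) • w + (2 * ⟪c, w⟫_ℂ) • c := by
    rw [EuclideanSpace.real_norm_sq_eq]
    ext i
    fin_cases i <;>
    · simp [matCLM, potential, c, PiLp.inner_apply, Matrix.mulVec, dotProduct]
      ring
  rw [e]
  refine (norm_add_le _ _).trans ?_
  rw [norm_smul, norm_smul, norm_mul, Complex.norm_real, hc, Real.norm_of_nonneg (by positivity)]
  have h := norm_inner_le_norm (𝕜 := ℂ) c w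
  rw [hc] at h
  have h2 : ‖⟪c, w⟫_ℂ‖ * ‖v‖ ≤ ‖v‖ * ‖w‖ * ‖v‖ := by gcongr
  rw [Complex.norm_ofNat]
  nlinarith

theorem inner_matCLM_potential (v : EuclideanSpace ℝ (Fin 2)) (a b : C2) :
    ⟪matCLM (potential v) a, b⟫_ℂ = ⟪a, matCLM (potential v) b⟫_ℂ := by
  simp [matCLM, potential, PiLp.inner_apply, Matrix.mulVec, dotProduct]
  ring

theorem norm_mulPotential_le (u : LInf) (w : L2) :
    ‖mulPotential u w‖ ≤ 3 * ‖u‖ ^ 2 * ‖w‖ := by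
  apply Lp.norm_le_mul_norm_of_ae_le_mul
  have hu : ∀ᵐ x, ‖u x‖ ≤ ‖u‖ := by
    filter_upwards [ae_le_lpNorm_exponent_top (Lp.memLp u)] with x hx
    rwa [← toReal_eLpNorm (Lp.aestronglyMeasurable u), ← Lp.norm_def] at hx
  filter_upwards [hu, (memLp_potential u w).coeFn_toLp] with x h1 h2
  change ‖((memLp_potential u w).toLp _ : L2) x‖ ≤ _
  rw [h2]
  refine (norm_matCLM_potential_le _ _).trans ?_
  gcongr

theorem inner_mulPotential (u : LInf) (v w : L2) :
    ⟪mulPotential u v, w⟫_ℂ = ⟪v, mulPotential u w⟫_ℂ := by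
  rw [L2.inner_def, L2.inner_def]
  apply integral_congr_ae
  filter_upwards [(memLp_potential u v).coeFn_toLp, (memLp_potential u w).coeFn_toLp] with x h1 h2
  change ⟪((memLp_potential u v).toLp _ : L2) x, w x⟫_ℂ =
    ⟪v x, ((memLp_potential u w).toLp _ : L2) x⟫_ℂ
  rw [h1, h2, inner_matCLM_potential]

end LLE

theorem lemma3p1 (ρ : ℝ) (hρ : 0 < ρ) (ζ : ℝ) :
    ∃ η₁ η₂ : ℝ, 0 < η₁ ∧ 0 < η₂ ∧ ∀ u : LLE.LInf, ‖u‖ ≤ ρ →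
      LLE.spectrum (LLE.linearization ζ u) ∩
        ({z : ℂ | η₁ ≤ |z.re|} ∪ {z : ℂ | η₂ ≤ |z.im| ∧ z.re ≠ 0}) = ∅ := by
  have hC : 0 ≤ 3 * ρ ^ 2 := by positivity
  refine ⟨3 * ρ ^ 2 + 1, |ζ| + 4 * (3 * ρ ^ 2) + 4, by positivity, by positivity, fun u hu => ?_⟩
  have hV : ∀ w, ‖LLE.mulPotential u w‖ ≤ 3 * ρ ^ 2 * ‖w‖ := fun w =>
    (LLE.norm_mulPotential_le u w).trans (by gcongr)
  have hS : ∀ y : LLE.L2, ∃ w : LLE.H2,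
      (-LLE.secondDeriv) w + (((2 * Real.pi) ^ 2 : ℝ) : ℂ) • (w : LLE.L2) = y := by
    intro y
    obtain ⟨w, hw⟩ := LLE.exists_besselTwo_eq ((((2 * Real.pi) ^ 2 : ℝ) : ℂ)⁻¹ • y)
    have hpi : (((2 * Real.pi) ^ 2 : ℝ) : ℂ) ≠ 0 := by
      exact_mod_cast (by positivity : (2 * Real.pi) ^ 2 ≠ 0)
    refine ⟨w, ?_⟩
    rw [LLE.neg_secondDeriv_eq, ← smul_add, sub_add_cancel, hw, smul_smul, mul_inv_cancel₀ hpi,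
      one_smul]
  rw [Set.eq_empty_iff_forall_notMem]
  rintro z ⟨hz1, hz2⟩
  refine hz1 ?_
  obtain ⟨R, hR1, hR2⟩ := LLE.exists_resolvent (V := (LLE.mulPotential u).mkContinuous _ hV)
    LLE.isHamiltonianPair (by positivity) hS (LLE.inner_mulPotential u) hC hV ζ hz2
  refine ⟨R, fun y => ?_, fun x => ?_⟩
  · obtain ⟨hy, h⟩ := hR1 y
    exact ⟨hy, h⟩
  · exact hR2 x
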